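/- Let $G$ be an abelian group that has no element of order $2$ and no element of order $3$. Let $\Delta(G)$ be the augmentation ideal of the integral group ring $\mathbb{Z}G$, let $\mathcal{V}(\mathbb{Z}G)$ be the group of units of $\mathbb{Z}G$ of augmentation one, and for $n\ge 1$ put $\mathcal{V}_n(\mathbb{Z}G)=\mathcal{V}(\mathbb{Z}G)\cap(1+\Delta^n(G))$. Then the $\Delta$-adic residue $$\mathcal{V}_\omega(\mathbb{Z}G):=\bigcap_{n\ge 1}\mathcal{V}_n(\mathbb{Z}G)$$ is trivial, i.e. equal to $\{1\}$, if and only if $G$ is torsion-free or there is a prime $p$ such that the torsion subgroup $T$ of $G$ is a $p$-group in which no element other than the identity has infinite $p$-height. Here an element $g$ of a group $H$ has infinite $p$-height in $H$ if for all natural numbers $i$ and $j\geq 1$ there exist $x\in H$ and $y\in\gamma_j(H)$ with $x^{p^i}=gy$, where $\gamma_j(H)$ denotes the $j$-th term of the lower central series of $H$ (with $\gamma_1(H)=H$). -/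

import Mathlib

namespace DeltaAdic

noncomputable section

/-- The augmentation homomorphism `ℤG → ℤ`, sending every group element to `1`. -/
def augmentation (G : Type*) [Group G] : MonoidAlgebra ℤ G →ₐ[ℤ] ℤ :=
  MonoidAlgebra.lift ℤ ℤ G (1 : G →* ℤ)

theorem augmentation_single {G : Type*} [Group G] (g : G) (a : ℤ) :
    augmentation G (MonoidAlgebra.single g a) = a := by
  simp [augmentation, MonoidAlgebra.lift_single]

/-- The augmentation ideal `Δ(G)` of the integral group ring `ℤG`. -/
def augmentationIdeal (G : Type*) [Group G] : Ideal (MonoidAlgebra ℤ G) :=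
  RingHom.ker (augmentation G)

instance (G : Type*) [Group G] : (augmentationIdeal G).IsTwoSided :=
  inferInstanceAs (RingHom.ker (augmentation G)).IsTwoSided

/-- The group `𝒱(ℤG)` of normalized units: the units of `ℤG` of augmentation one. -/
def normalizedUnits (G : Type*) [Group G] : Subgroup (MonoidAlgebra ℤ G)ˣ where
  carrier := {u | augmentation G (u : MonoidAlgebra ℤ G) = 1}
  one_mem' := by simp
  mul_mem' := by
    intro u v hu hv
    simp only [Set.mem_ofPred_eq] at hu hv ⊢
    simp [hu, hv]
  inv_mem' := by
    intro u hu
    simp only [Set.mem_ofPred_eq] at hu ⊢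
    have h := congrArg (augmentation G) u.mul_inv
    rwa [map_mul, hu, one_mul, map_one] at h

/-- The `n`-th term `𝒱ₙ(ℤG) = 𝒱(ℤG) ∩ (1 + Δⁿ(G))` of the `Δ`-adic filtration. -/
def deltaFiltration (G : Type*) [Group G] (n : ℕ) : Subgroup (MonoidAlgebra ℤ G)ˣ where
  carrier := {u | u ∈ normalizedUnits G ∧
    (u : MonoidAlgebra ℤ G) - 1 ∈ augmentationIdeal G ^ n}
  one_mem' := ⟨one_mem _, by simp⟩
  mul_mem' := by
    rintro u v ⟨hu, hu'⟩ ⟨hv, hv'⟩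
    refine ⟨mul_mem hu hv, ?_⟩
    have e : ((u * v : (MonoidAlgebra ℤ G)ˣ) : MonoidAlgebra ℤ G) - 1
        = u * ((v : MonoidAlgebra ℤ G) - 1) + ((u : MonoidAlgebra ℤ G) - 1) := by
      rw [Units.val_mul, mul_sub, mul_one, sub_add_sub_cancel]
    rw [e]
    exact add_mem (Ideal.mul_mem_left _ _ hv') hu'
  inv_mem' := by
    rintro u ⟨hu, hu'⟩
    refine ⟨inv_mem hu, ?_⟩
    have e : ((u⁻¹ : (MonoidAlgebra ℤ G)ˣ) : MonoidAlgebra ℤ G) - 1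
        = -((u⁻¹ : (MonoidAlgebra ℤ G)ˣ) : MonoidAlgebra ℤ G)
            * ((u : MonoidAlgebra ℤ G) - 1) := by
      rw [neg_mul, mul_sub, mul_one, Units.inv_mul, neg_sub]
    rw [e]
    exact Ideal.mul_mem_left _ _ hu'

/-- The `Δ`-adic residue `𝒱_ω(ℤG) = ⋂_{n ≥ 1} 𝒱ₙ(ℤG)`. -/
def deltaResidue (G : Type*) [Group G] : Subgroup (MonoidAlgebra ℤ G)ˣ :=
  ⨅ n : ℕ, ⨅ _ : 1 ≤ n, deltaFiltration G n

/-- `g` has infinite `p`-height in `G`: for all `i` and all `j ≥ 1` there are `x ∈ G` and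
`y ∈ γⱼ(G)` with `x ^ (p ^ i) = g * y`.  Mathlib numbers the lower central series from `0`, so
that `γⱼ(G)` is `(⊤ : Subgroup G).lowerCentralSeries (j - 1)`. -/
def HasInfinitePHeight {G : Type*} [Group G] (p : ℕ) (g : G) : Prop :=
  ∀ i j : ℕ, 1 ≤ j → ∃ x : G, ∃ y ∈ (⊤ : Subgroup G).lowerCentralSeries (j - 1), x ^ (p ^ i) = g * y

end

end DeltaAdic

/-! Necessity: for torsion `c` of order prime to 6, `f(c) = 1 - c + c²` is a unit, and `f(ab) -
f(a)f(b) = (a-1)(b-1)(a+b)`. If `a, b ≠ 1` are torsion and `(a-1)(b-1)` lies in every `Δⁿ`, then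
`f(ab)f(a)⁻¹f(b)⁻¹` is a nontrivial residue element (`deltaResidue_ne_bot`). Such pairs exist when
two primes occur in `T`, or when `T` is a `p`-group with an element `a = b ≠ 1` of infinite
`p`-height.

Sufficiency: let `A = G/T`, which is torsion-free, and let `χ` be a character of `p`-power order
with values in `R = ℤ[ζ]`. The map `g ↦ χ(g)π(g)` sends a residue unit to a unit of `R[A]`, hence to
a monomial; Krull's intersection theorem and `Δ/Δ² ≅ A` force that monomial to be `1`
(`extend_twist_eq_one`). Without elements of infinite `p`-height these characters separate `T`, so
linear independence on each coset of `T` gives `u = 1`. -/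

namespace DeltaAdic

open MonoidAlgebra

/-! ### Nontrivial residue units from torsion elements -/

section Forward

variable {G : Type*} [CommGroup G]

/-- Modulo `Φ₆(c)` the order of `c` divides both `6` and `n`, so `c = 1` and `Φ₆(1) = 1` vanishes.
-/
theorem isUnit_one_sub_add_sq {B : Type*} [CommRing B] {c : B} {n : ℕ} (hc : c ^ n = 1)
    (hn : Nat.Coprime n 6) : IsUnit (1 - c + c ^ 2) := by
  rw [← Ideal.span_singleton_eq_top]
  set J := Ideal.span {1 - c + c ^ 2} with hJ
  set f := Ideal.Quotient.mk J
  have h0 : 1 - f c + f c ^ 2 = 0 := by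
    have : f (1 - c + c ^ 2) = 0 :=
      Ideal.Quotient.eq_zero_iff_mem.2 (Ideal.mem_span_singleton_self _)
    simpa using this
  have h6 : f c ^ 6 = 1 := by linear_combination (f c ^ 4 + f c ^ 3 - f c - 1) * h0
  have h1 : f c = 1 := by
    have hfn : f c ^ n = 1 := by rw [← map_pow, hc, map_one]
    rw [← pow_one (f c), ← hn.gcd_eq_one]
    exact pow_gcd_eq_one.2 ⟨hfn, h6⟩
  rw [Ideal.eq_top_iff_one, ← Ideal.Quotient.eq_zero_iff_mem]
  rw [map_one]
  rw [h1] at h0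
  linear_combination h0

theorem augmentation_of (g : G) : augmentation G (of ℤ G g) = 1 := by
  rw [of_apply, augmentation_single]

theorem of_sub_one_mem (g : G) : of ℤ G g - 1 ∈ augmentationIdeal G := by
  rw [augmentationIdeal, RingHom.mem_ker, map_sub, map_one, augmentation_of, sub_self]

theorem geom_sum_sub_mem (g : G) (m : ℕ) :
    ∑ i ∈ Finset.range m, of ℤ G g ^ i - (m : MonoidAlgebra ℤ G) ∈ augmentationIdeal G := by
  rw [augmentationIdeal, RingHom.mem_ker]
  simp only [map_sub, map_sum, map_pow, augmentation_of, map_natCast]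
  simp

/-- An element `g` of exponent `m` satisfies `m (g - 1) ∈ (g - 1) Δ(G)`. -/
theorem exists_natCast_mul_of_sub_one {g : G} {m : ℕ} (hg : g ^ m = 1) :
    ∃ d ∈ augmentationIdeal G, (m : MonoidAlgebra ℤ G) * (of ℤ G g - 1) = (of ℤ G g - 1) * d := by
  refine ⟨_, neg_mem (geom_sum_sub_mem g m), ?_⟩
  have h := geom_sum_mul (of ℤ G g) m
  rw [← map_pow, hg, map_one, sub_self] at h
  linear_combination h

theorem mul_mem_pow_of_coprime {a b : G} {m n : ℕ} (ha : a ^ m = 1) (hb : b ^ n = 1)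
    (hmn : Nat.Coprime m n) (k : ℕ) :
    (of ℤ G a - 1) * (of ℤ G b - 1) ∈ augmentationIdeal G ^ k := by
  obtain ⟨d, hd, hda⟩ := exists_natCast_mul_of_sub_one ha
  obtain ⟨e, he, heb⟩ := exists_natCast_mul_of_sub_one hb
  obtain ⟨r, s, hrs⟩ := (Nat.isCoprime_iff_coprime.2 hmn)
  have hrs' : (r : MonoidAlgebra ℤ G) * m + s * n = 1 := by
    exact_mod_cast congrArg (Int.cast : ℤ → MonoidAlgebra ℤ G) hrs
  -- By Bézout the product reproduces itself times an element of `Δ`, so it climbs through all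
  -- powers.
  have key : (of ℤ G a - 1) * (of ℤ G b - 1)
      = (of ℤ G a - 1) * (of ℤ G b - 1) * (r * d + s * e) := by
    linear_combination (r * (of ℤ G b - 1)) * hda + (s * (of ℤ G a - 1)) * heb
      - (of ℤ G a - 1) * (of ℤ G b - 1) * hrs'
  induction k with
  | zero => simp
  | succ k ih =>
    rw [key, pow_succ]
    exact Ideal.mul_mem_mul ih (add_mem (Ideal.mul_mem_left _ _ hd) (Ideal.mul_mem_left _ _ he))

/-- Induction via `y^m - 1 = (1 + y + ⋯ + y^(m-1))(y - 1)`, whose first factor is `m` modulo `Δ`. -/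
theorem pow_pow_sub_one_mem (x : G) (m n : ℕ) :
    of ℤ G (x ^ m ^ n) - 1 ∈ Ideal.span {(m : MonoidAlgebra ℤ G)} ⊔ augmentationIdeal G ^ n := by
  induction n with
  | zero => simp
  | succ n ih =>
    obtain ⟨y, hy, δ, hδ, h⟩ := Submodule.mem_sup.1 ih
    obtain ⟨r, rfl⟩ := Ideal.mem_span_singleton'.1 hy
    have he := geom_sum_sub_mem (x ^ m ^ n) m
    have hs := geom_sum_mul (of ℤ G (x ^ m ^ n)) m
    rw [pow_succ m, pow_mul, map_pow, ← hs, ← h]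
    generalize ∑ i ∈ Finset.range m, of ℤ G (x ^ m ^ n) ^ i = S at he
    have : S * (r * m + δ) = (S * r + δ) * m + δ * (S - m) := by ring
    rw [this]
    refine Submodule.add_mem_sup (Ideal.mul_mem_left _ _ (Ideal.mem_span_singleton_self _)) ?_
    rw [pow_succ]
    exact Ideal.mul_mem_mul hδ he

theorem mul_mem_pow_of_divisible {g t : G} {m : ℕ} (ht : t ^ m = 1)
    (hg : ∀ i, ∃ x : G, x ^ m ^ i = g) (n : ℕ) :
    (of ℤ G g - 1) * (of ℤ G t - 1) ∈ augmentationIdeal G ^ n := by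
  obtain ⟨d, hd, hdt⟩ := exists_natCast_mul_of_sub_one ht
  have hpow : ∀ j : ℕ, (m : MonoidAlgebra ℤ G) ^ j * (of ℤ G t - 1) = (of ℤ G t - 1) * d ^ j := by
    intro j
    induction j with
    | zero => simp
    | succ j ih =>
      rw [pow_succ, pow_succ]
      linear_combination (m : MonoidAlgebra ℤ G) * ih + d ^ j * hdt
  -- `m^(n*n) = (m^n)^n`: working modulo `m^n` is needed because `m^n (t - 1)` lies in `Δⁿ`.
  obtain ⟨x, rfl⟩ := hg (n * n)
  obtain ⟨y, hy, δ, hδ, h⟩ := Submodule.mem_sup.1 (pow_pow_sub_one_mem x (m ^ n) n)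
  obtain ⟨r, rfl⟩ := Ideal.mem_span_singleton'.1 hy
  rw [pow_mul, ← h, add_mul]
  refine add_mem ?_ (Ideal.mul_mem_right _ _ hδ)
  rw [Nat.cast_pow, mul_assoc, hpow]
  exact Ideal.mul_mem_left _ _ (Ideal.mul_mem_left _ _ (Ideal.pow_mem_pow hd n))

theorem coprime_orderOf_six (hG : ∀ g : G, orderOf g ≠ 2 ∧ orderOf g ≠ 3) {a : G}
    (ha : IsOfFinOrder a) : Nat.Coprime (orderOf a) 6 := by
  have key : ∀ q, q ∣ orderOf a → ∃ b : G, orderOf b = q := fun q hq =>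
    ⟨_, orderOf_pow_orderOf_div ha.orderOf_pos.ne' hq⟩
  rw [show 6 = 2 * 3 from rfl, Nat.coprime_mul_iff_right, Nat.coprime_comm,
    Nat.Prime.coprime_iff_not_dvd Nat.prime_two, Nat.coprime_comm,
    Nat.Prime.coprime_iff_not_dvd Nat.prime_three]
  exact ⟨fun h => (key _ h).elim fun b hb => (hG b).1 hb,
    fun h => (key _ h).elim fun b hb => (hG b).2 hb⟩

/-- The coefficient at `ab` is at most `-2`: the positive terms `a`, `b`, `a²b`, `ab²` all differ
from `ab`. -/
theorem mul_add_ne_zero {a b : G} (ha : a ≠ 1) (hb : b ≠ 1) :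
    (of ℤ G a - 1) * (of ℤ G b - 1) * (of ℤ G a + of ℤ G b) ≠ 0 := by
  classical
  intro h
  have h' : of ℤ G a + of ℤ G b + of ℤ G (a * (a * b)) + of ℤ G (a * b * b) - of ℤ G (a * a)
      - of ℤ G (b * b) - of ℤ G (a * b) - of ℤ G (a * b) = 0 := by
    simp only [map_mul]
    linear_combination h
  have h2 := congrArg (fun x => x.coeff (a * b)) h'
  simp only [of_apply, coeff_sub, coeff_add, coeff_single, Finsupp.coe_sub, Finsupp.coe_add,
    Pi.sub_apply, Pi.add_apply, Finsupp.single_apply, coeff_zero, Finsupp.coe_zero,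
    Pi.zero_apply, left_eq_mul, right_eq_mul, mul_eq_right, mul_eq_left, ha, hb] at h2
  grind

/-- Two nontrivial torsion elements whose augmentation product lies in `Δ^ω(G)` yield a
nontrivial unit in the `Δ`-adic residue. -/
theorem deltaResidue_ne_bot (hG : ∀ g : G, orderOf g ≠ 2 ∧ orderOf g ≠ 3) {a b : G}
    (ha : a ≠ 1) (hb : b ≠ 1) (hat : IsOfFinOrder a) (hbt : IsOfFinOrder b)
    (hab : ∀ n, (of ℤ G a - 1) * (of ℤ G b - 1) ∈ augmentationIdeal G ^ n) :
    deltaResidue G ≠ ⊥ := by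
  have key : ∀ c : G, IsOfFinOrder c → ∃ u : (MonoidAlgebra ℤ G)ˣ,
      (u : MonoidAlgebra ℤ G) = 1 - of ℤ G c + of ℤ G c ^ 2 ∧ u ∈ normalizedUnits G := by
    intro c hc
    obtain ⟨u, hu⟩ := isUnit_one_sub_add_sq (c := of ℤ G c) (n := orderOf c)
      (by rw [← map_pow, pow_orderOf_eq_one, map_one]) (coprime_orderOf_six hG hc)
    refine ⟨u, hu, ?_⟩
    change augmentation G u = 1
    simp [hu, augmentation_single]
  obtain ⟨u, hu, hu1⟩ := key a hat
  obtain ⟨v, hv, hv1⟩ := key b hbt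
  obtain ⟨w, hw, hw1⟩ := key (a * b) (hat.mul hbt)
  have hdiff : (w : MonoidAlgebra ℤ G) - v * u
      = (of ℤ G a - 1) * (of ℤ G b - 1) * (of ℤ G a + of ℤ G b) := by
    rw [hu, hv, hw, map_mul]; ring
  intro hbot
  have hmem : w * u⁻¹ * v⁻¹ ∈ deltaResidue G := by
    simp only [deltaResidue, Subgroup.mem_iInf]
    refine fun n _ => ⟨mul_mem (mul_mem hw1 (inv_mem hu1)) (inv_mem hv1), ?_⟩
    have : ((w * u⁻¹ * v⁻¹ : (MonoidAlgebra ℤ G)ˣ) : MonoidAlgebra ℤ G) - 1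
        = ((w : MonoidAlgebra ℤ G) - v * u) * ((u⁻¹ * v⁻¹ : (MonoidAlgebra ℤ G)ˣ)) := by
      rw [← Units.val_mul v u, sub_mul, ← Units.val_mul, ← Units.val_mul, mul_assoc w,
        mul_assoc v, mul_inv_cancel_left, mul_inv_cancel, Units.val_one]
    rw [this, hdiff, mul_assoc]
    exact Ideal.mul_mem_right _ _ (hab n)
  rw [hbot, Subgroup.mem_bot, mul_inv_eq_one, mul_inv_eq_iff_eq_mul] at hmem
  rw [hmem, Units.val_mul, sub_self] at hdiff
  exact mul_add_ne_zero ha hb hdiff.symm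

theorem isMulTorsionFree_or_isPGroup (hG : ∀ g : G, orderOf g ≠ 2 ∧ orderOf g ≠ 3)
    (h : deltaResidue G = ⊥) :
    IsMulTorsionFree G ∨ ∃ p : ℕ, p.Prime ∧ IsPGroup p (CommGroup.torsion G) ∧
      ∀ t : CommGroup.torsion G, HasInfinitePHeight p t → t = 1 := by
  refine or_iff_not_imp_left.2 fun hT => ?_
  obtain ⟨a, ha1, ha⟩ := not_isMulTorsionFree_iff_isOfFinOrder.1 hT
  have hpr : (orderOf a).minFac.Prime := Nat.minFac_prime (by simpa using ha1)
  set p := (orderOf a).minFac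
  have hex : ∀ {t : G} {q : ℕ}, IsOfFinOrder t → q ∣ orderOf t → ∃ b : G, orderOf b = q :=
    fun ht hq => ⟨_, orderOf_pow_orderOf_div ht.orderOf_pos.ne' hq⟩
  have hne : ∀ {c : G} {q : ℕ}, q.Prime → orderOf c = q → c ≠ 1 ∧ IsOfFinOrder c := by
    rintro c q hq rfl
    exact ⟨fun h1 => hq.ne_one (by simp [h1]), orderOf_pos_iff.1 hq.pos⟩
  obtain ⟨b, hb⟩ := hex ha (Nat.minFac_dvd _)
  have hp : IsPGroup p (CommGroup.torsion G) := by
    rintro ⟨t, ht⟩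
    have ht' : IsOfFinOrder t := ht
    have hord := Nat.eq_prime_pow_of_unique_prime_dvd (p := p) ht'.orderOf_pos.ne' (by
      intro q hq hqt
      by_contra hqp
      obtain ⟨c, hc⟩ := hex ht' hqt
      exact deltaResidue_ne_bot hG (hne hpr hb).1 (hne hq hc).1 (hne hpr hb).2 (hne hq hc).2
        (mul_mem_pow_of_coprime (orderOf_dvd_iff_pow_eq_one.1 hb.dvd) (orderOf_dvd_iff_pow_eq_one.1 hc.dvd)
          ((Nat.coprime_primes hpr hq).2 (Ne.symm hqp))) h)
    exact ⟨_, Subtype.ext (hord ▸ pow_orderOf_eq_one t)⟩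
  refine ⟨p, hpr, hp, fun t ht => ?_⟩
  by_contra ht1
  have ht1' : (t : G) ≠ 1 := fun h1 => ht1 (Subtype.ext h1)
  obtain ⟨k, hk⟩ := hp t
  refine deltaResidue_ne_bot hG ht1' ht1' t.2 t.2
    (mul_mem_pow_of_divisible (m := p ^ k) (by exact_mod_cast congrArg Subtype.val hk) ?_) h
  intro i
  -- `j = 2` is chosen because `γ₂` of an abelian group is trivial, which forces `y = 1`.
  obtain ⟨x, y, hy, hxy⟩ := ht (k * i) 2 (by norm_num)
  have hy1 : y = 1 := by
    have : (⊤ : Subgroup (CommGroup.torsion G)).lowerCentralSeries (2 - 1) = ⊥ := by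
      exact Subgroup.lowerCentralSeries_one_eq_bot_iff.2 inferInstance
    rwa [this, Subgroup.mem_bot] at hy
  refine ⟨x, ?_⟩
  rw [← pow_mul, ← SubmonoidClass.coe_pow, hxy, hy1, mul_one]

end Forward

/-! ### Units over torsion-free groups and twisted homomorphisms -/

section Backward

/-- Only finitely many elements are involved, so the finitely generated case suffices. -/
theorem twoUniqueProds_of_isMulTorsionFree (A : Type*) [CommGroup A] [IsMulTorsionFree A] :
    TwoUniqueProds A where
  uniqueMul_of_one_lt_card := by
    classical
    intro S T hST
    set H : Subgroup A := Subgroup.closure (S ∪ T : Finset A) with hH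
    have : Group.FG H := (Group.fg_iff_subgroup_fg H).2 ⟨_, rfl⟩
    have : IsMulTorsionFree H := H.subtype_injective.isMulTorsionFree H.subtype
    have hsub : ∀ {X : Finset A}, X ⊆ S ∪ T →
        (X.subtype (· ∈ H)).map (Function.Embedding.subtype _) = X := fun hX =>
      Finset.subtype_map_of_mem fun x hx => Subgroup.subset_closure (hX hx)
    have hS := hsub (X := S) Finset.subset_union_left
    have hT := hsub (X := T) Finset.subset_union_right
    have hcard : 1 < (S.subtype (· ∈ H)).card * (T.subtype (· ∈ H)).card := by
      rwa [← Finset.card_map (Function.Embedding.subtype _), hS,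
        ← Finset.card_map (Function.Embedding.subtype _), hT]
    obtain ⟨p, hp, q, hq, hne, hup, huq⟩ := TwoUniqueProds.uniqueMul_of_one_lt_card hcard
    have hmap := fun a b => UniqueMul.mulHom_map_iff (A := S.subtype (· ∈ H))
      (B := T.subtype (· ∈ H)) (a0 := a) (b0 := b) (Function.Embedding.subtype _)
      (fun _ _ => rfl)
    rw [hS, hT] at hmap
    simp only [Finset.mem_product, Finset.mem_subtype] at hp hq
    refine ⟨(p.1, p.2), by simpa using hp, (q.1, q.2), by simpa using hq, ?_,
      (hmap _ _).2 hup, (hmap _ _).2 huq⟩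
    intro h
    simp only [Prod.mk.injEq] at h
    exact hne (Prod.ext (Subtype.ext h.1) (Subtype.ext h.2))

/-- Units of a monoid algebra with two unique products over a domain are monomials. -/
theorem eq_single_of_mul_eq_one {R A : Type*} [CommRing R] [IsDomain R] [CommGroup A]
    [TwoUniqueProds A] {u w : MonoidAlgebra R A} (h : u * w = 1) :
    ∃ f z, u = single f z := by
  classical
  by_cases hc : 1 < u.coeff.support.card * w.coeff.support.card
  · exfalso
    obtain ⟨p, hp, q, hq, hne, hup, huq⟩ := TwoUniqueProds.uniqueMul_of_one_lt_card hc
    -- A uniquely represented product has nonzero coefficient in `u * w = 1`, so it equals `1`; two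
    -- such pairs contradict uniqueness.
    have key : ∀ r ∈ u.coeff.support ×ˢ w.coeff.support,
        UniqueMul u.coeff.support w.coeff.support r.1 r.2 → r.1 * r.2 = 1 := by
      intro r hr hur
      rw [Finset.mem_product, Finsupp.mem_support_iff, Finsupp.mem_support_iff] at hr
      have h1 := coeff_mul_mul_of_uniqueMul hur
      rw [h, one_def, coeff_single, Finsupp.single_apply] at h1
      by_contra hr1
      rw [if_neg (Ne.symm hr1)] at h1
      exact mul_ne_zero hr.1 hr.2 h1.symm
    rw [Finset.mem_product] at hq
    have := hup hq.1 hq.2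
      ((key q (Finset.mem_product.2 hq) huq).trans (key p hp hup).symm)
    exact hne (Prod.ext this.1.symm this.2.symm)
  · have hw : w.coeff.support.card ≠ 0 := by
      intro h0
      rw [Finset.card_eq_zero, Finsupp.support_eq_empty, coeff_eq_zero] at h0
      rw [h0, mul_zero] at h
      exact zero_ne_one h
    have hu : u.coeff.support.card ≤ 1 := by
      by_contra hu
      exact hc (by nlinarith [Nat.pos_of_ne_zero hw])
    obtain ⟨f, z, hfz⟩ := Finsupp.card_support_le_one'.1 hu
    exact ⟨f, z, MonoidAlgebra.ext hfz⟩

/-- The ring homomorphism `ℤG → B` induced by a homomorphism from `G` to the monoid `B`. -/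
noncomputable def extend {G B : Type*} [Group G] [CommRing B] (F : G →* B) :
    MonoidAlgebra ℤ G →+* B :=
  (MonoidAlgebra.lift ℤ B G F).toRingHom

theorem extend_single {G B : Type*} [Group G] [CommRing B] (F : G →* B) (g : G) (n : ℤ) :
    extend F (single g n) = n * F g := by
  simp [extend]

theorem ringHom_ext_int {G B : Type*} [Group G] [Ring B] {f h : MonoidAlgebra ℤ G →+* B}
    (H : ∀ g, f (single g 1) = h (single g 1)) : f = h :=
  MonoidAlgebra.ringHom_ext' (Subsingleton.elim _ _) (MonoidHom.ext H)

theorem augmentationIdeal_le_comap_extend {G B : Type*} [Group G] [CommRing B] (F : G →* B)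
    (I : Ideal B) (hF : ∀ g, F g - 1 ∈ I) : augmentationIdeal G ≤ I.comap (extend F) := by
  intro x hx
  rw [Ideal.mem_comap, ← Ideal.Quotient.eq_zero_iff_mem]
  have h : (Ideal.Quotient.mk I).comp (extend F)
      = (Int.castRingHom (B ⧸ I)).comp (augmentation G).toRingHom := by
    refine ringHom_ext_int fun g => ?_
    have := (Ideal.Quotient.eq (I := I)).2 (hF g)
    simp [extend_single, this, augmentation_single]
  have h' := DFunLike.congr_fun h x
  have hx' : augmentation G x = 0 := hx
  simpa [hx'] using h'

theorem augmentationIdeal_pow_le_comap_extend {G B : Type*} [CommGroup G] [CommRing B] (F : G →* B)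
    (I : Ideal B) (hF : ∀ g, F g - 1 ∈ I) (n : ℕ) :
    augmentationIdeal G ^ n ≤ (I ^ n).comap (extend F) :=
  (Ideal.pow_right_mono (augmentationIdeal_le_comap_extend F I hF) n).trans
    (Ideal.le_comap_pow _ n)

/-- The additive homomorphism `ℤA → A` that restricts to the identity on `A`. -/
noncomputable def linearize (A : Type*) [CommGroup A] : MonoidAlgebra ℤ A →+ Additive A :=
  (Finsupp.liftAddHom fun a => zmultiplesHom _ (Additive.ofMul a)).comp
    coeffAddEquiv.toAddMonoidHom

theorem linearize_single {A : Type*} [CommGroup A] (a : A) (n : ℤ) :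
    linearize A (single a n) = n • Additive.ofMul a := by
  change (Finsupp.single a n).sum (fun x => zmultiplesHom _ (Additive.ofMul x)) = _
  rw [Finsupp.sum_single_index (by simp), zmultiplesHom_apply]

theorem linearize_mul {A : Type*} [CommGroup A] (x y : MonoidAlgebra ℤ A) :
    linearize A (x * y)
      = augmentation A x • linearize A y + augmentation A y • linearize A x := by
  induction x using induction_linear with
  | zero => simp
  | add x x' hx hx' => rw [add_mul, map_add, hx, hx', map_add, map_add, add_smul, smul_add]; abel
  | single a m =>
    induction y using induction_linear with
    | zero => simp
    | add y y' hy hy' => rw [mul_add, map_add, hy, hy', map_add, map_add, add_smul, smul_add]; abel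
    | single b n =>
      rw [single_mul_single, linearize_single, linearize_single, linearize_single,
        augmentation_single, augmentation_single, ofMul_mul, smul_add, smul_smul, smul_smul,
        mul_comm n m, add_comm]

/-- `linearize` is a derivation along the augmentation, so it kills `Δ²`, yet it sends `a - 1` to
`a`. -/
theorem eq_one_of_of_sub_one_mem_sq {A : Type*} [CommGroup A] {a : A}
    (h : of ℤ A a - 1 ∈ augmentationIdeal A ^ 2) : a = 1 := by
  have key : ∀ x ∈ augmentationIdeal A ^ 2, linearize A x = 0 := by
    intro x hx
    rw [pow_two] at hx
    refine Submodule.mul_induction_on hx (fun y hy z hz => ?_) fun y z hy hz => ?_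
    · rw [linearize_mul, show augmentation A y = 0 from hy, show augmentation A z = 0 from hz,
        zero_smul, zero_smul, add_zero]
    · rw [map_add, hy, hz, add_zero]
  have := key _ h
  rw [of_apply, one_def, map_sub, linearize_single, linearize_single] at this
  simpa using this

variable {G A R : Type*} [CommGroup G] [CommGroup A] [CommRing R]

theorem sub_one_mem_of_mem_deltaResidue {u : (MonoidAlgebra ℤ G)ˣ} (hu : u ∈ deltaResidue G)
    (n : ℕ) : (u : MonoidAlgebra ℤ G) - 1 ∈ augmentationIdeal G ^ n := by
  simp only [deltaResidue, Subgroup.mem_iInf] at hu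
  rcases n with _ | n
  · simp
  · exact (hu (n + 1) n.succ_pos).2

/-- The homomorphism `g ↦ χ(g) π(g)` from `G` to the group algebra `R[A]`. -/
noncomputable def twist (χ : G →* R) (π : G →* A) : G →* MonoidAlgebra R A where
  toFun g := single (π g) (χ g)
  map_one' := by rw [map_one, map_one, one_def]
  map_mul' g h := by rw [map_mul, map_mul, single_mul_single]

theorem map_eq_of_of_mem_deltaResidue [IsMulTorsionFree A] (π : G →* A)
    {u : (MonoidAlgebra ℤ G)ˣ} (hu : u ∈ deltaResidue G) :
    extend ((of ℤ A).comp π) u = 1 := by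
  have := twoUniqueProds_of_isMulTorsionFree A
  obtain ⟨f, z, hf⟩ := eq_single_of_mul_eq_one (u := extend ((of ℤ A).comp π) u)
    (w := extend ((of ℤ A).comp π) ↑u⁻¹) (by rw [← map_mul, u.mul_inv, map_one])
  have hmem : ∀ n, extend ((of ℤ A).comp π) u - 1 ∈ augmentationIdeal A ^ n := by
    intro n
    rw [← map_one (extend ((of ℤ A).comp π)), ← map_sub]
    exact augmentationIdeal_pow_le_comap_extend ((of ℤ A).comp π) (augmentationIdeal A)
      (fun g => of_sub_one_mem _) n (sub_one_mem_of_mem_deltaResidue hu n)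
  have h1 := hmem 1
  rw [pow_one, augmentationIdeal, RingHom.mem_ker, hf, map_sub, augmentation_single, map_one,
    sub_eq_zero] at h1
  subst h1
  have h2 := hmem 2
  rw [hf, ← of_apply] at h2
  rw [hf, eq_one_of_of_sub_one_mem_sq h2, one_def]

/-- Krull's theorem gives `χ(u) = 1`, so the monomial has coefficient `1`. Modulo `I` the twist
disappears, and the untwisted image is `1`, so its group element is `1` too. -/
theorem extend_twist_eq_one [IsMulTorsionFree A] [IsDomain R] [IsNoetherianRing R] {I : Ideal R}
    (hI : I ≠ ⊤) {χ : G →* R} (hχ : ∀ g, χ g - 1 ∈ I) (π : G →* A) {u : (MonoidAlgebra ℤ G)ˣ}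
    (hu : u ∈ deltaResidue G) : extend (twist χ π) u = 1 := by
  have hχu : extend χ u = 1 := by
    rw [← sub_eq_zero, ← map_one (extend χ), ← map_sub, ← Ideal.mem_bot,
      ← Ideal.iInf_pow_eq_bot_of_isDomain I hI, Ideal.mem_iInf]
    exact fun n => augmentationIdeal_pow_le_comap_extend χ I hχ n
      (sub_one_mem_of_mem_deltaResidue hu n)
  have := twoUniqueProds_of_isMulTorsionFree A
  obtain ⟨f, z, hf⟩ := eq_single_of_mul_eq_one (u := extend (twist χ π) u)
    (w := extend (twist χ π) ↑u⁻¹) (by rw [← map_mul, u.mul_inv, map_one])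
  have hε : (MonoidAlgebra.lift R R A 1).toRingHom.comp (extend (twist χ π)) = extend χ :=
    ringHom_ext_int fun g => by simp [extend_single, twist]
  have hz : z = 1 := by
    have := DFunLike.congr_fun hε (u : MonoidAlgebra ℤ G)
    rw [hχu] at this
    simpa [hf] using this
  subst hz
  have : Nontrivial (R ⧸ I) := Ideal.Quotient.nontrivial_iff.2 hI
  have hρ : (mapRingHom A (Ideal.Quotient.mk I)).comp (extend (twist χ π))
      = (extend (of (R ⧸ I) A)).comp (extend ((of ℤ A).comp π)) := by
    refine ringHom_ext_int fun g => ?_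
    have := (Ideal.Quotient.eq (I := I)).2 (hχ g)
    simp [extend_single, twist, this]
  have h1 := DFunLike.congr_fun hρ (u : MonoidAlgebra ℤ G)
  rw [RingHom.comp_apply, RingHom.comp_apply, map_eq_of_of_mem_deltaResidue π hu, hf, map_one,
    mapRingHom_single, map_one, one_def, single_left_inj one_ne_zero] at h1
  rw [hf, h1, one_def]

end Backward

/-! ### Characters of `p`-power order and separation of torsion -/

section Characters

/-- `p` divides `(ζ - 1)^(p^k)`, so a unit `ζ - 1` would make `1/p` integral over `ℤ`. -/
theorem adjoin_primitiveRoot_span_ne_top {p k : ℕ} (hp : p.Prime) {ζ : ℂ} (hζ : ζ ^ p ^ k = 1) :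
    Ideal.span {(⟨ζ, Algebra.self_mem_adjoin_singleton ℤ ζ⟩ - 1 : Algebra.adjoin ℤ {ζ})} ≠ ⊤ := by
  set z : Algebra.adjoin ℤ {ζ} := ⟨ζ, Algebra.self_mem_adjoin_singleton ℤ ζ⟩ with hz
  intro htop
  have hu := Ideal.span_singleton_eq_top.1 htop
  have hz1 : z ^ p ^ k = 1 := Subtype.ext hζ
  obtain ⟨r, hr⟩ := exists_add_pow_prime_pow_eq hp (z - 1) 1 k
  rw [sub_add_cancel, hz1, one_pow] at hr
  have hpu : IsUnit (p : Algebra.adjoin ℤ {ζ}) := by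
    refine isUnit_of_dvd_unit ?_ (hu.pow (p ^ k))
    exact ⟨-((z - 1) * r), by linear_combination -hr⟩
  obtain ⟨q, hq⟩ := hpu.exists_right_inv
  have hpos : 0 < p ^ k := pow_pos hp.pos k
  have hζint : IsIntegral ℤ ζ := IsIntegral.of_pow hpos (hζ ▸ isIntegral_one)
  have hqint : IsIntegral ℤ (q : ℂ) :=
    (mem_integralClosure_iff ℤ ℂ).1
      (adjoin_le_integralClosure hζint q.2)
  have hq' : (p : ℂ) * q = 1 := by exact_mod_cast congrArg Subtype.val hq
  have hp0 : (p : ℂ) ≠ 0 := by exact_mod_cast hp.ne_zero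
  have hqr : (q : ℂ) = algebraMap ℚ ℂ (1 / p) := by
    rw [map_div₀, map_one, map_natCast, eq_div_iff hp0, mul_comm, hq']
  rw [hqr, isIntegral_algebraMap_iff (algebraMap ℚ ℂ).injective,
    IsIntegrallyClosed.isIntegral_iff] at hqint
  obtain ⟨y, hy⟩ := hqint
  have hp0' : (p : ℚ) ≠ 0 := by exact_mod_cast hp.ne_zero
  have h1 : (p : ℤ) * y = 1 := by
    rw [eq_div_iff hp0', mul_comm] at hy
    rw [eq_intCast] at hy
    exact_mod_cast hy
  have := Int.isUnit_iff_natAbs_eq.1 (IsUnit.of_mul_eq_one _ h1)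
  exact hp.ne_one (by simpa using this)

/-- A nontrivial element of an abelian group is detected by a complex character. -/
theorem exists_character_ne_one {H : Type*} [CommGroup H] {h : H} (hh : h ≠ 1) :
    ∃ χ : H →* ℂ, χ h ≠ 1 := by
  obtain ⟨c, hc⟩ := CharacterModule.exists_character_apply_ne_zero_of_ne_zero
    (A := Additive H) (a := Additive.ofMul h) (by simpa using hh)
  -- `q ↦ exp(2πiq)` embeds `ℚ/ℤ` into `ℂˣ`, turning the `ℚ/ℤ`-valued character into a complex one.
  let E : ℚ →+ Additive ℂˣ :=
    { toFun := fun q => Additive.ofMul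
        (Units.mk0 (Complex.exp (2 * Real.pi * Complex.I * q)) (Complex.exp_ne_zero _))
      map_zero' := by
        rw [← ofMul_one]; congr 1; ext; simp
      map_add' := fun a b => by
        rw [← ofMul_mul]; congr 1; ext; simp [mul_add, Complex.exp_add] }
  have hE : ∀ q, E q = 0 ↔ q ∈ AddSubgroup.zmultiples (1 : ℚ) := by
    intro q
    have h0 : E q = 0 ↔ Complex.exp (2 * Real.pi * Complex.I * q) = 1 :=
      Units.ext_iff (u := Units.mk0 _ (Complex.exp_ne_zero _)) (v := 1)
    rw [h0, Complex.exp_eq_one_iff, AddSubgroup.mem_zmultiples_iff]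
    refine exists_congr fun n => ?_
    rw [mul_comm, mul_left_inj' Complex.two_pi_I_ne_zero, zsmul_one, eq_comm]
    norm_cast
  let e : AddCircle (1 : ℚ) →+ Additive ℂˣ :=
    QuotientAddGroup.lift _ E fun q hq => (hE q).2 hq
  have he : ∀ x, e x = 0 → x = 0 := by
    intro x
    induction x using QuotientAddGroup.induction_on with
    | H q =>
      intro hx
      exact (QuotientAddGroup.eq_zero_iff q).2 ((hE q).1 hx)
  let c' : Additive H →+ AddCircle (1 : ℚ) := c
  refine ⟨(Units.coeHom ℂ).comp (MonoidHom.toAdditive.symm (e.comp c')), fun h1 => ?_⟩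
  refine hc (he _ ?_)
  have : ((e (c' (Additive.ofMul h))).toMul : ℂ) = 1 := h1
  exact congrArg Additive.ofMul (Units.ext this)

variable {G : Type*} [CommGroup G]

/-- The complex characters of `G` whose order divides a power of `p`. -/
def primePowerCharacters (G : Type*) [CommGroup G] (p : ℕ) : Submonoid (G →* ℂ) where
  carrier := {χ | ∃ k : ℕ, ∀ g, χ g ^ p ^ k = 1}
  one_mem' := ⟨0, fun g => by simp⟩
  mul_mem' := by
    rintro χ ψ ⟨k, hk⟩ ⟨l, hl⟩
    refine ⟨k + l, fun g => ?_⟩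
    rw [MonoidHom.mul_apply, mul_pow, pow_add, pow_mul, hk, one_pow, mul_comm (p ^ k), pow_mul,
      hl, one_pow, one_mul]

/-- Characters of `G/G^(p^i)` have exponent dividing `p^i`, and `t` survives in this quotient. -/
theorem exists_primePowerCharacter_ne_one {p i : ℕ} {t : G} (ht : ∀ x : G, x ^ p ^ i ≠ t) :
    ∃ χ ∈ primePowerCharacters G p, χ t ≠ 1 := by
  let N := (powMonoidHom (p ^ i) : G →* G).range
  have hN : (QuotientGroup.mk' N t) ≠ 1 := by
    intro h
    obtain ⟨x, hx⟩ := (QuotientGroup.eq_one_iff t).1 h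
    exact ht x hx
  obtain ⟨χ, hχ⟩ := exists_character_ne_one hN
  refine ⟨χ.comp (QuotientGroup.mk' N), ⟨i, fun g => ?_⟩, hχ⟩
  have : QuotientGroup.mk' N (g ^ p ^ i) = 1 := (QuotientGroup.eq_one_iff _).2 ⟨g, rfl⟩
  rw [MonoidHom.comp_apply, ← map_pow, ← map_pow, this, map_one]

theorem extend_twist_primePowerCharacter {A : Type*} [CommGroup A] [IsMulTorsionFree A] {p : ℕ}
    (hp : p.Prime) {χ : G →* ℂ} (hχ : χ ∈ primePowerCharacters G p) (π : G →* A)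
    {u : (MonoidAlgebra ℤ G)ˣ} (hu : u ∈ deltaResidue G) : extend (twist χ π) u = 1 := by
  obtain ⟨k, hk⟩ := hχ
  have hpk : p ^ k ≠ 0 := pow_ne_zero k hp.ne_zero
  have : NeZero (p ^ k) := ⟨hpk⟩
  have hζ := Complex.isPrimitiveRoot_exp (p ^ k) hpk
  generalize Complex.exp (2 * Real.pi * Complex.I / ↑(p ^ k)) = ζ at hζ
  set R := Algebra.adjoin ℤ {ζ} with hR
  have : Algebra.FiniteType ℤ R :=
    (Subalgebra.fg_iff_finiteType _).1 ⟨{ζ}, by simp [hR]⟩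
  have : IsNoetherianRing R := Algebra.FiniteType.isNoetherianRing ℤ R
  have hroot : ∀ g, ∃ i, ζ ^ i = χ g := fun g =>
    (hζ.eq_pow_of_pow_eq_one (hk g)).imp fun _ h => h.2
  have hmem : ∀ g, χ g ∈ R := fun g => by
    obtain ⟨i, hi⟩ := hroot g
    rw [← hi]
    exact pow_mem (Algebra.self_mem_adjoin_singleton ℤ ζ) i
  have h := extend_twist_eq_one (adjoin_primitiveRoot_span_ne_top hp hζ.pow_eq_one)
    (χ := χ.codRestrict R hmem) (fun g => by
      obtain ⟨i, hi⟩ := hroot g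
      rw [Ideal.mem_span_singleton]
      have : χ.codRestrict R hmem g
          = (⟨ζ, Algebra.self_mem_adjoin_singleton ℤ ζ⟩ : R) ^ i := Subtype.ext hi.symm
      rw [this]
      exact sub_one_dvd_pow_sub_one _ _) π hu
  have hcomp : (mapRingHom A R.val.toRingHom).comp (extend (twist (χ.codRestrict R hmem) π))
      = extend (twist χ π) := ringHom_ext_int fun g => by
    simp [extend_single, twist]
  rw [← hcomp, RingHom.comp_apply, h, map_one]

theorem coeff_extend_twist {A R : Type*} [CommGroup A] [DecidableEq A] [CommRing R] (χ : G →* R)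
    (π : G →* A) (x : MonoidAlgebra ℤ G) (a : A) :
    (extend (twist χ π) x).coeff a
      = ∑ g ∈ x.coeff.support with π g = a, (x.coeff g : R) * χ g := by
  conv_lhs => rw [← sum_coeff_single x]
  rw [Finsupp.sum, map_sum, coeff_sum, Finsupp.finsetSum_apply, Finset.sum_filter]
  refine Finset.sum_congr rfl fun g _ => ?_
  rw [extend_single, ← zsmul_eq_mul, coeff_smul, Finsupp.smul_apply, zsmul_eq_mul]
  change _ * (single (π g) (χ g)).coeff a = _
  rw [coeff_single, Finsupp.single_apply, mul_ite, mul_zero]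

theorem deltaResidue_eq_bot {p : ℕ} (hp : p.Prime)
    (hT : ∀ t : CommGroup.torsion G, HasInfinitePHeight p t → t = 1) :
    deltaResidue G = ⊥ := by
  classical
  have hsep : ∀ t : G, IsOfFinOrder t → t ≠ 1 → ∃ χ ∈ primePowerCharacters G p, χ t ≠ 1 := by
    intro t ht ht1
    have hnot : ¬ HasInfinitePHeight p (⟨t, ht⟩ : CommGroup.torsion G) := fun h =>
      ht1 (congrArg Subtype.val (hT _ h))
    simp only [HasInfinitePHeight, not_forall, not_exists, not_and] at hnot
    obtain ⟨i, j, -, hij⟩ := hnot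
    refine exists_primePowerCharacter_ne_one (i := i) fun x hx => ?_
    have hxt : IsOfFinOrder x := by
      refine IsOfFinOrder.of_pow (n := p ^ i) (hx ▸ ht) (pow_ne_zero _ hp.ne_zero)
    exact hij ⟨x, hxt⟩ 1 (one_mem _) (Subtype.ext (by simpa using hx))
  refine (Subgroup.eq_bot_iff_forall _).2 fun u hu => Units.ext ?_
  set π := QuotientGroup.mk' (CommGroup.torsion G)
  set x : MonoidAlgebra ℤ G := u - 1 with hx
  have hx0 : ∀ χ ∈ primePowerCharacters G p, extend (twist χ π) x = 0 := fun χ hχ => by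
    rw [hx, map_sub, map_one, extend_twist_primePowerCharacter hp hχ π hu, sub_self]
  let ev : G → (primePowerCharacters G p →* ℂ) := fun g =>
    { toFun := fun χ => χ.1 g
      map_one' := rfl
      map_mul' := fun _ _ => rfl }
  rw [Units.val_one, ← sub_eq_zero, ← hx]
  refine MonoidAlgebra.ext (Finsupp.ext fun g₀ => ?_)
  by_contra hg₀
  -- Two elements of one coset differ by torsion, so distinct ones are separated by a character.
  -- Their evaluations are then distinct homomorphisms to `ℂ`, and Dedekind's lemma applies.
  have hinj : Function.Injective fun g : {g // π g = π g₀} => ev g := by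
    rintro ⟨g, hg⟩ ⟨h, hh⟩ hgh
    by_contra hne
    have hgh' : π (g / h) = 1 := by rw [map_div, hg, hh, div_self']
    obtain ⟨χ, hχ, hχ1⟩ := hsep (g / h) ((QuotientGroup.eq_one_iff _).1 hgh')
      (fun h1 => hne (Subtype.ext (div_eq_one.1 h1)))
    have h2 : χ g = χ h := DFunLike.congr_fun hgh ⟨χ, hχ⟩
    refine hχ1 ?_
    have h3 : χ (g / h) * χ h = 1 * χ h := by rw [← map_mul, div_mul_cancel, one_mul, h2]
    exact mul_right_cancel₀ (fun h0 => one_ne_zero (α := ℂ) (by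
      rw [← map_one χ, ← mul_inv_cancel h, map_mul, h0, zero_mul])) h3
  have hlin := (linearIndependent_monoidHom (primePowerCharacters G p) ℂ).comp _ hinj
  have := linearIndependent_iff'.1 hlin (x.coeff.support.subtype fun g => π g = π g₀)
    (fun g => (x.coeff g : ℂ)) ?_ ⟨g₀, rfl⟩ (by simpa using hg₀)
  · exact hg₀ (by exact_mod_cast this)
  · ext χ
    have h1 := congrArg (fun y => y.coeff (π g₀)) (hx0 χ.1 χ.2)
    simp only [coeff_extend_twist, coeff_zero, Finsupp.coe_zero, Pi.zero_apply] at h1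
    rw [← Finset.sum_subtype_eq_sum_filter] at h1
    rw [Finset.sum_apply]
    exact h1

end Characters
end DeltaAdic

theorem mainTheorem6 (G : Type*) [CommGroup G]
    (hG : ∀ g : G, orderOf g ≠ 2 ∧ orderOf g ≠ 3) :
    DeltaAdic.deltaResidue G = ⊥ ↔
      (IsMulTorsionFree G ∨
        ∃ p : ℕ, p.Prime ∧ IsPGroup p (CommGroup.torsion G) ∧
          ∀ t : CommGroup.torsion G, DeltaAdic.HasInfinitePHeight p t → t = 1) := by
  refine ⟨DeltaAdic.isMulTorsionFree_or_isPGroup hG, ?_⟩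
  rintro (h | ⟨p, hp, -, hT⟩)
  -- With trivial torsion any prime serves; `2` is arbitrary.
  · exact DeltaAdic.deltaResidue_eq_bot Nat.prime_two fun t _ =>
      Subtype.ext (IsOfFinOrder.eq_one' t.2)
  · exact DeltaAdic.deltaResidue_eq_bot hp hT
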